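/- **Setting.** Let $\mathbb G,\mathbb G_T$ be groups of prime order $p$ with a pairing $e:\mathbb G\times\mathbb G\to\mathbb G_T$ such that $e(u^a,v^b)=e(u,v)^{ab}$ and $e(u,v)\ne 1$ whenever $u,v\neq 1$. Let $KDF:\mathbb G_T\to\{0,1\}^\ell$ be a function and let $(\mathsf E,\mathsf D)$ be a symmetric encryption scheme with keys in $\{0,1\}^\ell$ and ciphertexts in $\{0,1\}^*$, where $\mathsf D$ outputs $\perp$ to reject. A master public key consists of $g,X,h,Y_A,Y_B,Z\in\mathbb G$ and a function $H:\mathbb G\times\mathbb G\times\mathbb G_T\to\mathbb Z_p^*$; write $F(\mathsf{ID})=g^{\mathsf{ID}}Z$ for $\mathsf{ID}\in\mathbb Z_p$. Consider the following identity-based scheme. * *Keygen.* The user draws $t_0,\theta\in\mathbb Z_p^*$ uniformly, sends $R=h^{t_0}X^\theta$ to the key generator (PKG) and gives an interactive, perfectly witness indistinguishable proof of knowledge of $(t_0,\theta)$. The PKG returns two triples $(d'_{A,1},d'_{A,2},d'_{A,3})$ and $(d'_{B,1},d'_{B,2},d'_{B,3})$ in $\mathbb G\times\mathbb G\times\mathbb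 Z_p$. (The honest PKG, with $X=g^x$, returns $\big((Y_A R h^{t'_A})^{1/x}F(\mathsf{ID})^{r'_A},X^{r'_A},t'_A\big)$ and $\big((Y_Bh^{t_B})^{1/x}F(\mathsf{ID})^{r'_B},X^{r'_B},t_B\big)$ for random $r'_A,t'_A,r'_B,t_B\in\mathbb Z_p^*$.) The user draws $r''_A,r''_B\in\mathbb Z_p^*$ uniformly and forms the key with the triples $d_A=(d'_{A,1}g^{-\theta}F(\mathsf{ID})^{r''_A},\,d'_{A,2}X^{r''_A},\,d'_{A,3}+t_0)$ and $d_B=(d'_{B,1}F(\mathsf{ID})^{r''_B},\,d'_{B,2}X^{r''_B},\,d'_{B,3})$. He accepts it if it is valid, that is, if for both $W\in\{A,B\}$, $e(d_{W,1},X)=e(Y_W,g)\,e(h,g)^{d_{W,3}}\,e(F(\mathsf{ID}),d_{W,2})$. * *Encrypt.* For random $s\in\mathbb Z_p^*$, the ciphertext of $m$ is $\big(X^s,F(\mathsf{ID})^s,e(g,h)^s,\mathsf E_K(m)\big)$ with $K=KDF\big(e(g,Y_A)^s e(g,Y_B)^{\kappa s}\big)$ and $\kappa=H(C_1,C_2,C_3)$.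 * *Decrypt.* The output on $(C_1,C_2,C_3,C_4)$ is $\mathsf D_K(C_4)$, where $\kappa=H(C_1,C_2,C_3)$ and $K=KDF\Big(\dfrac{e(C_1,d_{A,1}d_{B,1}^\kappa)}{e(C_2,d_{A,2}d_{B,2}^\kappa)\,C_3^{\,d_{A,3}+\kappa d_{B,3}}}\Big)$. * *Trace.* The output is $d_{A,3}$ (the family number) if the key is valid, and $\perp$ otherwise. **FindKey-CCA game.** The adversary $\mathcal A$, a dishonest PKG, chooses the master public key and $\mathsf{ID}$. The user rejects the master public key if $g=1$ or $X=1$. Then $\mathcal A$ runs the key generation protocol with the honest user, who obtains $d^{(1)}$ and aborts if it is not valid. Next $\mathcal A$ makes at most $q_d$ adaptive decryption queries, which are answered with $d^{(1)}$. Finally $\mathcal A$ outputs a key $d^{(2)}$. She wins if the user neither rejected nor aborted and $\mathbf{Trace}(d^{(2)})=\mathbf{Trace}(d^{(1)})$. Her advantage is her probability of winning. **Assumptions.** Costs are sizes of (non-uniform) Boolean circuits, in NAND gates. Let $\mathbf{Adv}^{\mathsf{KDF}}_s$ be the supremum of $\big|\Pr[B(KDF(\gamma))=1]-\Pr[B(K)=1]\big|$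 over circuits $B$ of size at most $s$, with $\gamma\in\mathbb G_T$ and $K\in\{0,1\}^\ell$ uniform. Let $\mathbf{Adv}^{\mathsf{CT\text{-}INT}}_L$ (weak ciphertext integrity) be the supremum of $\Pr[\mathsf D_K(c')\ne\perp]$, with $K$ uniform, over randomized adversaries that receive nothing and output a string $c'$ of at most $L$ bits. **Theorem.** 1. Let $q_d\ge 1$ and suppose that, for each ciphertext length up to $L$, a circuit of size at most $s$ decides from $(K,c)$ whether $\mathsf D_K(c)=\perp$. Then every adversary $\mathcal A$, even computationally unbounded, that makes at most $q_d$ decryption queries, all with $|C_4|\le L$, satisfies $$\mathbf{Adv}^{\mathrm{FindKey\text{-}CCA}}_{\mathcal A}\le 2q_d\,\mathbf{Adv}^{\mathsf{CT\text{-}INT}}_L+2q_d\,\mathbf{Adv}^{\mathsf{KDF}}_s+\frac{2q_d^2+q_d+1}{p}.$$ 2. Consequently the scheme is FindKey-CCA secure. Take a family of such systems indexed by $\lambda\in\mathbb N$ with $p>2^\lambda$, such that for every polynomially bounded $L(\lambda)$ rejection by $\mathsf D$ on ciphertexts of at most $L(\lambda)$ bits is decided by circuits of polynomially bounded size. Suppose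 that every family of polynomial-size distinguishers has negligible advantage against $KDF$, and that every family of adversaries with output of polynomially bounded length has negligible advantage against weak ciphertext integrity. Then every family of adversaries with polynomially bounded number of decryption queries and polynomially bounded query lengths has negligible FindKey-CCA advantage. -/

import Mathlib

noncomputable section

open scoped Classical

namespace AIBE

/-! ### Boolean circuits (the measure of computational cost) -/

/-- What a gate may read: a constant, one of the `n` inputs, or one of `k` earlier gates. -/
inductive Wire (n k : ℕ) : Type
  | const (b : Bool)
  | input (i : Fin n)
  | gate (j : Fin k)

/-- The value on a wire, from the input bits and the values of the gates. -/
def Wire.eval {n k : ℕ} (x : Fin n → Bool) (v : Fin k → Bool) : Wire n k → Bool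
  | .const b => b
  | .input i => x i
  | .gate j => v j

/-- A sequence of `k` NAND gates, each reading constants, inputs and earlier gates. -/
inductive Gates (n : ℕ) : ℕ → Type
  | nil : Gates n 0
  | nand {k : ℕ} (gs : Gates n k) (a b : Wire n k) : Gates n (k + 1)

/-- The values of all gates. -/
def Gates.eval {n : ℕ} (x : Fin n → Bool) : {k : ℕ} → Gates n k → (Fin k → Bool)
  | _, .nil => Fin.elim0
  | _, .nand gs a b =>
      Fin.snoc (gs.eval x) (!(a.eval x (gs.eval x) && b.eval x (gs.eval x)))

/-- A Boolean circuit with `n` input bits and one output bit; `size` is its number of gates. -/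
structure Circuit (n : ℕ) where
  size : ℕ
  gates : Gates n size
  out : Wire n size

def Circuit.eval {n : ℕ} (C : Circuit n) (x : Fin n → Bool) : Bool :=
  C.out.eval x (C.gates.eval x)

/-! ### Building blocks of the scheme -/

/-- A symmetric pairing between groups of prime order `p`. -/
structure Pairing (G GT : Type) [CommGroup G] [CommGroup GT] where
  e : G → G → GT
  bilinear : ∀ (u v : G) (a b : ℤ), e (u ^ a) (v ^ b) = e u v ^ (a * b)
  nondegenerate : ∀ u v : G, u ≠ 1 → v ≠ 1 → e u v ≠ 1

/-- A symmetric encryption scheme with keys in `{0,1}^ℓ` and ciphertexts in `{0,1}^*`.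
Decryption yields `none` (that is, `⊥`) when it rejects. -/
structure SymEnc (ℓ : ℕ) (M : Type) where
  enc : (Fin ℓ → Bool) → M → PMF (List Bool)
  dec : (Fin ℓ → Bool) → List Bool → Option M
  correct : ∀ K m, ∀ c ∈ (enc K m).support, dec K c = some m

/-- The prover of an interactive proof of knowledge of a representation `(t, θ)` of
`R = h ^ t * X ^ θ`.  In each round the prover sends a message, which depends on `(h, X)`, on his
witness, on his coins and on the messages he received so far, and the verifier answers. -/
structure Prover (p : ℕ) (G : Type) where
  rounds : ℕ
  PMsg : Type
  VMsg : Type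
  Coin : Type
  coin : PMF Coin
  next : G → G → (ZMod p)ˣ × (ZMod p)ˣ → Coin → List VMsg → PMsg

/-- The messages of the verifier and of the prover after `n` rounds. -/
def interact {PMsg VMsg : Type} (prover : List VMsg → PMsg) (verifier : List PMsg → VMsg) :
    ℕ → List VMsg × List PMsg
  | 0 => ([], [])
  | n + 1 =>
      let prev := interact prover verifier n
      let ps := prev.2 ++ [prover prev.1]
      (prev.1 ++ [verifier ps], ps)

/-- The prover's messages in a complete run against a verifier strategy. -/
def Prover.run {p : ℕ} {G : Type} (W : Prover p G) (h X : G) (w : (ZMod p)ˣ × (ZMod p)ˣ)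
    (verifier : List W.PMsg → W.VMsg) (ρ : W.Coin) : List W.PMsg :=
  (interact (W.next h X w ρ) verifier W.rounds).2

/-- The commitment `h ^ t * X ^ θ`. -/
def commit {p : ℕ} {G : Type} [CommGroup G] (h X : G) (w : (ZMod p)ˣ × (ZMod p)ˣ) : G :=
  h ^ (w.1 : ZMod p).val * X ^ (w.2 : ZMod p).val

/-- Perfect witness indistinguishability: whatever a (malicious, unbounded) verifier does, the
distribution of its view is the same for any two witnesses of the same commitment. -/
def Prover.PerfectlyWI {p : ℕ} {G : Type} [CommGroup G] (W : Prover p G) : Prop :=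
  ∀ (h X : G) (w w' : (ZMod p)ˣ × (ZMod p)ˣ), commit h X w = commit h X w' →
    ∀ verifier : List W.PMsg → W.VMsg,
      W.coin.map (W.run h X w verifier) = W.coin.map (W.run h X w' verifier)

/-- The system in which the scheme is run, at one value of the security parameters. -/
structure System where
  p : ℕ
  prime : Fact p.Prime
  G : Type
  GT : Type
  commGroupG : CommGroup G
  commGroupGT : CommGroup GT
  fintypeGT : Fintype GT
  card_G : Nat.card G = p
  card_GT : Nat.card GT = p
  pairing : Pairing G GT
  ℓ : ℕ
  M : Type
  kdf : GT → (Fin ℓ → Bool)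
  sym : SymEnc ℓ M
  prover : Prover p G

attribute [instance] System.prime System.commGroupG System.commGroupGT System.fintypeGT

namespace System

variable (P : System)

/-! ### The scheme -/

/-- The part of the master public key that the PKG generates. -/
structure MPK where
  g : P.G
  X : P.G
  h : P.G
  YA : P.G
  YB : P.G
  Z : P.G
  H : P.G → P.G → P.GT → (ZMod P.p)ˣ

structure Triple where
  d1 : P.G
  d2 : P.G
  d3 : ZMod P.p

structure Key where
  A : P.Triple
  B : P.Triple

structure Ciphertext where
  C1 : P.G
  C2 : P.G
  C3 : P.GT
  C4 : List Bool

variable {P}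

/-- `F(ID) = g ^ ID * Z`. -/
def MPK.F (mpk : P.MPK) (ID : ZMod P.p) : P.G := mpk.g ^ ID.val * mpk.Z

/-- The user's sanity check: `g` generates the group and `X = g ^ x` with `x ∈ ℤ_p^*`. -/
def MPK.Sane (mpk : P.MPK) : Prop := mpk.g ≠ 1 ∧ mpk.X ≠ 1

/-- The honest PKG's answer to the commitment `R` (its master key being `x`). -/
def MPK.issue (mpk : P.MPK) (x : (ZMod P.p)ˣ) (ID : ZMod P.p) (R : P.G)
    (rA tA rB tB : (ZMod P.p)ˣ) : P.Key where
  A := { d1 := (mpk.YA * R * mpk.h ^ (tA : ZMod P.p).val) ^ ((x⁻¹ : (ZMod P.p)ˣ) : ZMod P.p).val *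
                mpk.F ID ^ (rA : ZMod P.p).val
         d2 := mpk.X ^ (rA : ZMod P.p).val
         d3 := tA }
  B := { d1 := (mpk.YB * mpk.h ^ (tB : ZMod P.p).val) ^ ((x⁻¹ : (ZMod P.p)ˣ) : ZMod P.p).val *
                mpk.F ID ^ (rB : ZMod P.p).val
         d2 := mpk.X ^ (rB : ZMod P.p).val
         d3 := tB }

/-- The key that the user computes from the PKG's answer `d'`, his opening `w = (t₀, θ)` of the
commitment and his blinding exponents `rA`, `rB`. -/
def MPK.unblind (mpk : P.MPK) (ID : ZMod P.p) (w : (ZMod P.p)ˣ × (ZMod P.p)ˣ)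
    (rA rB : (ZMod P.p)ˣ) (d' : P.Key) : P.Key where
  A := { d1 := d'.A.d1 / mpk.g ^ (w.2 : ZMod P.p).val * mpk.F ID ^ (rA : ZMod P.p).val
         d2 := d'.A.d2 * mpk.X ^ (rA : ZMod P.p).val
         d3 := d'.A.d3 + w.1 }
  B := { d1 := d'.B.d1 * mpk.F ID ^ (rB : ZMod P.p).val
         d2 := d'.B.d2 * mpk.X ^ (rB : ZMod P.p).val
         d3 := d'.B.d3 }

/-- `e(d₁, X) = e(Y, g) * e(h, g) ^ d₃ * e(F(ID), d₂)`. -/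
def MPK.TripleValid (mpk : P.MPK) (Y : P.G) (ID : ZMod P.p) (d : P.Triple) : Prop :=
  P.pairing.e d.d1 mpk.X =
    P.pairing.e Y mpk.g * P.pairing.e mpk.h mpk.g ^ d.d3.val * P.pairing.e (mpk.F ID) d.d2

def MPK.KeyValid (mpk : P.MPK) (ID : ZMod P.p) (d : P.Key) : Prop :=
  mpk.TripleValid mpk.YA ID d.A ∧ mpk.TripleValid mpk.YB ID d.B

/-- The family number of a valid key, `none` for an ill-formed one. -/
def MPK.trace (mpk : P.MPK) (ID : ZMod P.p) (d : P.Key) : Option (ZMod P.p) :=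
  if mpk.KeyValid ID d then some d.A.d3 else none

def MPK.encrypt (mpk : P.MPK) (ID : ZMod P.p) (m : P.M) : PMF P.Ciphertext :=
  (PMF.uniformOfFintype (ZMod P.p)ˣ).bind fun s =>
    let C1 := mpk.X ^ (s : ZMod P.p).val
    let C2 := mpk.F ID ^ (s : ZMod P.p).val
    let C3 := P.pairing.e mpk.g mpk.h ^ (s : ZMod P.p).val
    let κ : ZMod P.p := mpk.H C1 C2 C3
    let K := P.kdf (P.pairing.e mpk.g mpk.YA ^ (s : ZMod P.p).val *
      P.pairing.e mpk.g mpk.YB ^ (κ * s).val)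
    (P.sym.enc K m).map fun C4 => ⟨C1, C2, C3, C4⟩

def MPK.decrypt (mpk : P.MPK) (d : P.Key) (C : P.Ciphertext) : Option P.M :=
  let κ : ZMod P.p := mpk.H C.C1 C.C2 C.C3
  let ψ := P.pairing.e C.C1 (d.A.d1 * d.B.d1 ^ κ.val) /
    (P.pairing.e C.C2 (d.A.d2 * d.B.d2 ^ κ.val) * C.C3 ^ (d.A.d3 + κ * d.B.d3).val)
  P.sym.dec (P.kdf ψ) C.C4

/-! ### The FindKey-CCA game -/

variable (P)

/-- A dishonest PKG: a randomized strategy, without any bound on its computing power.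
Every move depends on its coins and on everything it has seen so far: the commitment `R`,
the prover's messages, and the answers to its decryption queries. -/
structure Adversary where
  Coin : Type
  coin : PMF Coin
  /-- the master public key and the identity -/
  setup : Coin → P.MPK × ZMod P.p
  /-- its messages in the proof of knowledge -/
  verifier : Coin → P.G → List P.prover.PMsg → P.prover.VMsg
  /-- its blinded key, sent at the end of the key generation protocol -/
  issue : Coin → P.G → List P.prover.PMsg → P.Key
  /-- its next decryption query, or `none` if it wants no further one -/
  query : Coin → P.G → List P.prover.PMsg → List (Option P.M) → Option P.Ciphertext
  /-- the key that it outputs in the end -/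
  findkey : Coin → P.G → List P.prover.PMsg → List (Option P.M) → P.Key

variable {P}

/-- The answers of a decryption oracle to at most `q` adaptive queries. -/
def answers (oracle : P.Ciphertext → Option P.M)
    (query : List (Option P.M) → Option P.Ciphertext) : ℕ → List (Option P.M)
  | 0 => []
  | q + 1 =>
      let prev := answers oracle query q
      match query prev with
      | none => prev
      | some C => prev ++ [oracle C]

/-- The FindKey-CCA game with at most `q` decryption queries.  The adversary loses if the user
rejects the master public key or the key resulting from the key generation protocol. -/
def findKeyGame (A : P.Adversary) (q : ℕ) : PMF Bool :=
  A.coin.bind fun ω =>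
    let mpk := (A.setup ω).1
    let ID := (A.setup ω).2
    if mpk.Sane then
      (PMF.uniformOfFintype ((ZMod P.p)ˣ × (ZMod P.p)ˣ)).bind fun w =>
        let R := commit mpk.h mpk.X w
        P.prover.coin.bind fun ρ =>
          let τ := P.prover.run mpk.h mpk.X w (A.verifier ω R) ρ
          (PMF.uniformOfFintype (ZMod P.p)ˣ).bind fun rA =>
            (PMF.uniformOfFintype (ZMod P.p)ˣ).bind fun rB =>
              let d := mpk.unblind ID w rA rB (A.issue ω R τ)
              if mpk.KeyValid ID d then
                let as := answers (mpk.decrypt d) (A.query ω R τ) q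
                let d₂ := A.findkey ω R τ as
                PMF.pure (decide (mpk.trace ID d = mpk.trace ID d₂))
              else PMF.pure false
    else PMF.pure false

/-- The FindKey-CCA advantage of an adversary with at most `q` decryption queries. -/
def Adversary.advantage (A : P.Adversary) (q : ℕ) : ℝ := (findKeyGame A q true).toReal

/-- The symmetric parts of all decryption queries have at most `L` bits. -/
def Adversary.QueryLength (A : P.Adversary) (L : ℕ) : Prop :=
  ∀ ω R τ as C, A.query ω R τ as = some C → C.C4.length ≤ L

/-! ### The assumptions -/

variable (P)

/-- Advantage of a circuit in telling `KDF(γ)`, for uniform `γ`, from a uniform key. -/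
def kdfAdvantage (B : Circuit P.ℓ) : ℝ :=
  |((PMF.uniformOfFintype P.GT).map (fun γ => B.eval (P.kdf γ)) true).toReal -
    ((PMF.uniformOfFintype (Fin P.ℓ → Bool)).map (fun K => B.eval K) true).toReal|

/-- The weak ciphertext integrity game: the adversary, who sees nothing, outputs a string and wins
if decryption under a fresh random key does not reject it. -/
def ctIntAdvantage (B : PMF (List Bool)) : ℝ :=
  (((PMF.uniformOfFintype (Fin P.ℓ → Bool)).bind fun K =>
    B.map fun c => (P.sym.dec K c).isSome) true).toReal

/-- Largest advantage against the key derivation function by circuits with at most `s` gates. -/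
def advKDF (s : ℕ) : ℝ := ⨆ B : {B : Circuit P.ℓ // B.size ≤ s}, P.kdfAdvantage B

/-- Largest weak ciphertext integrity advantage by adversaries that output at most `L` bits. -/
def advCTInt (L : ℕ) : ℝ :=
  ⨆ B : {B : PMF (List Bool) // ∀ c ∈ B.support, c.length ≤ L}, P.ctIntAdvantage B

/-- For ciphertexts of each length up to `L`, a circuit with at most `s` gates decides from the
key and the ciphertext whether symmetric decryption rejects. -/
def DecSize (L s : ℕ) : Prop :=
  ∀ m ≤ L, ∃ C : Circuit (P.ℓ + m), C.size ≤ s ∧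
    ∀ (K : Fin P.ℓ → Bool) (c : Fin m → Bool),
      C.eval (Fin.append K c) = (P.sym.dec K (List.ofFn c)).isSome

end System

/-! ### Asymptotic notions, for systems indexed by the security parameter -/

def PolyBounded (f : ℕ → ℕ) : Prop := ∃ Q : Polynomial ℕ, ∀ n, f n ≤ Q.eval n

def Negligible (f : ℕ → ℝ) : Prop :=
  Asymptotics.SuperpolynomialDecay Filter.atTop (fun n : ℕ => (n : ℝ)) f

/-- Symmetric decryption is efficient. -/
def EfficientDec (P : ℕ → System) : Prop :=
  ∀ L, PolyBounded L → ∃ s, PolyBounded s ∧ ∀ n, (P n).DecSize (L n) (s n)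

/-- The key derivation function is secure: polynomial-size distinguishers have negligible
advantage. -/
def SecureKDF (P : ℕ → System) : Prop :=
  ∀ B : (n : ℕ) → Circuit (P n).ℓ, PolyBounded (fun n => (B n).size) →
    Negligible fun n => (P n).kdfAdvantage (B n)

/-- Weak ciphertext integrity: adversaries with output of polynomial length have negligible
advantage. -/
def WeakCTInt (P : ℕ → System) : Prop :=
  ∀ L, PolyBounded L → ∀ B : ℕ → PMF (List Bool), (∀ n, ∀ c ∈ (B n).support, c.length ≤ L n) →
    Negligible fun n => (P n).ctIntAdvantage (B n)

/-- FindKey-CCA security: negligible advantage for all adversaries whose number of decryption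
queries and whose query lengths are polynomially bounded. -/
def FindKeyCCASecure (P : ℕ → System) : Prop :=
  ∀ (A : (n : ℕ) → (P n).Adversary) (q L : ℕ → ℕ), PolyBounded q → PolyBounded L →
    (∀ n, (A n).QueryLength (L n)) → Negligible fun n => (A n).advantage (q n)

end AIBE

end

section

open scoped Classical

namespace AIBE

/-! ### Exponents in groups of prime order -/

section Exponents

variable {p : ℕ} [Fact p.Prime] {G : Type} [CommGroup G]

/-! Conditionally on the PKG's view of the key generation protocol, perfect witness
indistinguishability leaves `(t₀, θ)` uniform on a fibre of the commitment
(`bind_uniform_bind_apply_le`). Such a fibre has at least `p - 2` elements, with pairwise distinct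
`t₀` (`MPK.card_le_card_fiber`, `MPK.fst_injOn_commit`). So a guess of the family number made from
this view alone succeeds with probability at most `1 / (p - 2)`, and it remains to see that
decryption queries hardly help.

Call a query well-formed if its first three components are those of an encryption with some exponent
`s`. On such a query all valid keys give the same answer, computable from `s`
(`MPK.decrypt_eq_publicDecrypt`). On an ill-formed query the KDF input is an injective function of
the user's remaining secrets: of the blinding exponent `rA`, or of the opening within its fibre
(`MPK.seed_injective_of_not_isHeader`). The user then accepts with probability at most `M / (p -
2)`, where `M` bounds the number of seeds under which a symmetric ciphertext is accepted. KDF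
security and weak ciphertext integrity make `M / p` small (`acceptCount_le`).

Compare the game with the one in which ill-formed queries are always rejected. There the queries are
determined by the view, so a union bound over them gives winning probability at most `(1 + q * M) /
(p - 2)` (`sum_win_le`).

Taking discrete logarithms to the bases `g` and `e(g, g)` turns each group identity into an identity
in the field `ZMod p`. -/

theorem pow_val_add (hc : Nat.card G = p) (g : G) (a b : ZMod p) :
    g ^ a.val * g ^ b.val = g ^ (a + b).val := by
  have h1 : g ^ p = 1 := hc ▸ pow_card_eq_one'
  rw [ZMod.val_add, ← pow_add, pow_eq_pow_mod _ h1]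

theorem pow_val_mul (hc : Nat.card G = p) (g : G) (a b : ZMod p) :
    (g ^ a.val) ^ b.val = g ^ (a * b).val := by
  have h1 : g ^ p = 1 := hc ▸ pow_card_eq_one'
  rw [ZMod.val_mul, ← pow_mul, pow_eq_pow_mod _ h1]

theorem pow_val_div (hc : Nat.card G = p) (g : G) (a b : ZMod p) :
    g ^ a.val / g ^ b.val = g ^ (a - b).val := by
  rw [div_eq_iff_eq_mul, pow_val_add hc, sub_add_cancel]

theorem pow_val_inj (hc : Nat.card G = p) {g : G} (hg : g ≠ 1) {a b : ZMod p} :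
    g ^ a.val = g ^ b.val ↔ a = b := by
  refine ⟨fun h => ?_, fun h => h ▸ rfl⟩
  have ho : orderOf g = p := by
    have := orderOf_dvd_natCard g
    rw [hc, Nat.dvd_prime Fact.out, orderOf_eq_one_iff] at this
    exact this.resolve_left hg
  rw [pow_inj_mod, ho, Nat.mod_eq_of_lt a.val_lt, Nat.mod_eq_of_lt b.val_lt] at h
  exact ZMod.val_injective p h

theorem exists_pow_val_eq (hc : Nat.card G = p) {g : G} (hg : g ≠ 1) (u : G) :
    ∃ a : ZMod p, g ^ a.val = u := by
  obtain ⟨n, rfl⟩ := mem_powers_of_prime_card hc hg (g' := u)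
  have h1 : g ^ p = 1 := hc ▸ pow_card_eq_one'
  exact ⟨n, by rw [ZMod.val_natCast, ← pow_eq_pow_mod _ h1]⟩

variable {GT : Type} [CommGroup GT]

theorem Pairing.e_pow_val (E : Pairing G GT) (hT : Nat.card GT = p) (g : G) (a b : ZMod p) :
    E.e (g ^ a.val) (g ^ b.val) = E.e g g ^ (a * b).val := by
  have := E.bilinear g g a.val b.val
  rw [zpow_natCast, zpow_natCast, zpow_mul, zpow_natCast, zpow_natCast] at this
  rw [this, pow_val_mul hT]

end Exponents

theorem Pairing.e_pow_val_left {p : ℕ} {G GT : Type} [CommGroup G] [CommGroup GT]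
    (E : Pairing G GT) (g : G) (a : ZMod p) :
    E.e (g ^ a.val) g = E.e g g ^ a.val := by
  simpa only [zpow_natCast, zpow_one, mul_one] using E.bilinear g g a.val 1

theorem Pairing.e_pow_val_right {p : ℕ} {G GT : Type} [CommGroup G] [CommGroup GT]
    (E : Pairing G GT) (g : G) (a : ZMod p) :
    E.e g (g ^ a.val) = E.e g g ^ a.val := by
  simpa only [zpow_natCast, zpow_one, one_mul] using E.bilinear g g 1 a.val


/-! ### Decryption with a valid key and with a blinded key -/

namespace System

variable {P : System}

/-- The input of the key derivation function in a decryption. -/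
def MPK.seed (mpk : P.MPK) (d : P.Key) (C : P.Ciphertext) : P.GT :=
  P.pairing.e C.C1 (d.A.d1 * d.B.d1 ^ (mpk.H C.C1 C.C2 C.C3 : ZMod P.p).val) /
    (P.pairing.e C.C2 (d.A.d2 * d.B.d2 ^ (mpk.H C.C1 C.C2 C.C3 : ZMod P.p).val) *
      C.C3 ^ (d.A.d3 + (mpk.H C.C1 C.C2 C.C3 : ZMod P.p) * d.B.d3).val)

theorem MPK.decrypt_eq (mpk : P.MPK) (d : P.Key) (C : P.Ciphertext) :
    mpk.decrypt d C = P.sym.dec (P.kdf (mpk.seed d C)) C.C4 := rfl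

/-- The first three components of `C` have the form that encryption with exponent `s` gives. -/
def MPK.IsHeader (mpk : P.MPK) (ID : ZMod P.p) (C : P.Ciphertext) (s : ZMod P.p) : Prop :=
  C.C1 = mpk.X ^ s.val ∧ C.C2 = mpk.F ID ^ s.val ∧ C.C3 = P.pairing.e mpk.g mpk.h ^ s.val

/-- Decryption that rejects ill-formed ciphertexts and uses the encryption exponent instead of
a key. -/
noncomputable def MPK.publicDecrypt (mpk : P.MPK) (ID : ZMod P.p) (C : P.Ciphertext) :
    Option P.M :=
  if hC : ∃ s, mpk.IsHeader ID C s then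
    P.sym.dec (P.kdf (P.pairing.e mpk.g mpk.YA ^ hC.choose.val *
      P.pairing.e mpk.g mpk.YB ^ ((mpk.H C.C1 C.C2 C.C3 : ZMod P.p) * hC.choose).val)) C.C4
  else none

theorem MPK.seed_of_isHeader {mpk : P.MPK} (hs : mpk.Sane) {ID : ZMod P.p} {d : P.Key}
    (hd : mpk.KeyValid ID d) {C : P.Ciphertext} {s : ZMod P.p} (hC : mpk.IsHeader ID C s) :
    mpk.seed d C = P.pairing.e mpk.g mpk.YA ^ s.val *
      P.pairing.e mpk.g mpk.YB ^ ((mpk.H C.C1 C.C2 C.C3 : ZMod P.p) * s).val := by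
  obtain ⟨g, X, h, YA, YB, Z, H⟩ := mpk
  obtain ⟨⟨a1, a2, a3⟩, ⟨b1, b2, b3⟩⟩ := d
  obtain ⟨C1, C2, C3, C4⟩ := C
  obtain ⟨hg, hX⟩ := hs
  obtain ⟨hA, hB⟩ := hd
  obtain ⟨hC1, hC2, hC3⟩ := hC
  simp only [MPK.TripleValid, MPK.F, MPK.seed] at *
  generalize (H C1 C2 C3 : ZMod P.p) = κ
  subst hC1 hC2 hC3
  have hE := P.pairing.nondegenerate g g hg hg
  obtain ⟨x, rfl⟩ := exists_pow_val_eq P.card_G hg X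
  obtain ⟨h, rfl⟩ := exists_pow_val_eq P.card_G hg h
  obtain ⟨yA, rfl⟩ := exists_pow_val_eq P.card_G hg YA
  obtain ⟨yB, rfl⟩ := exists_pow_val_eq P.card_G hg YB
  obtain ⟨z, rfl⟩ := exists_pow_val_eq P.card_G hg Z
  obtain ⟨a1, rfl⟩ := exists_pow_val_eq P.card_G hg a1
  obtain ⟨a2, rfl⟩ := exists_pow_val_eq P.card_G hg a2
  obtain ⟨b1, rfl⟩ := exists_pow_val_eq P.card_G hg b1
  obtain ⟨b2, rfl⟩ := exists_pow_val_eq P.card_G hg b2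
  simp only [pow_val_add P.card_G, pow_val_mul P.card_G, P.pairing.e_pow_val P.card_GT,
    P.pairing.e_pow_val_left, P.pairing.e_pow_val_right, pow_val_add P.card_GT,
    pow_val_mul P.card_GT, pow_val_div P.card_GT, pow_val_inj P.card_GT hE] at hA hB ⊢
  -- In exponents, the KDF input is the first validity equation times `s` plus the second times `s *
  -- κ`; the family numbers and the blinding cancel.
  linear_combination s * hA + s * κ * hB

theorem MPK.decrypt_eq_publicDecrypt {mpk : P.MPK} (hs : mpk.Sane) {ID : ZMod P.p} {d : P.Key}
    (hd : mpk.KeyValid ID d) {C : P.Ciphertext} (hC : ∃ s, mpk.IsHeader ID C s) :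
    mpk.decrypt d C = mpk.publicDecrypt ID C := by
  rw [MPK.decrypt_eq, MPK.publicDecrypt, dif_pos hC, MPK.seed_of_isHeader hs hd hC.choose_spec]

/-! ### Openings of a commitment, and what ill-formed ciphertexts reveal about them -/

theorem MPK.commit_eq_iff {mpk : P.MPK} (hs : mpk.Sane) :
    ∃ x η : ZMod P.p, x ≠ 0 ∧ ∀ w w' : (ZMod P.p)ˣ × (ZMod P.p)ˣ,
      commit mpk.h mpk.X w = commit mpk.h mpk.X w' ↔
        η * w.1 + x * w.2 = η * w'.1 + x * w'.2 := by
  obtain ⟨g, X, h, YA, YB, Z, H⟩ := mpk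
  obtain ⟨hg, hX⟩ := hs
  simp only [commit] at *
  obtain ⟨x, rfl⟩ := exists_pow_val_eq P.card_G hg X
  obtain ⟨η, rfl⟩ := exists_pow_val_eq P.card_G hg h
  refine ⟨x, η, by rintro rfl; simp at hX, fun w w' => ?_⟩
  simp only [pow_val_add P.card_G, pow_val_mul P.card_G, pow_val_inj P.card_G hg]

/-- Since `X ≠ 1`, the commitment and `t` determine `θ`. -/
theorem MPK.fst_injOn_commit {mpk : P.MPK} (hs : mpk.Sane) (R : P.G) :
    Set.InjOn Prod.fst {w : (ZMod P.p)ˣ × (ZMod P.p)ˣ | commit mpk.h mpk.X w = R} := by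
  obtain ⟨x, η, hx, h⟩ := MPK.commit_eq_iff hs
  rintro ⟨t, θ⟩ hw ⟨t', θ'⟩ hw' rfl
  have := (h _ _).1 (hw.trans hw'.symm)
  simp only [add_right_inj, mul_right_inj' hx, Units.val_inj] at this
  rw [this]

/-- For an ill-formed ciphertext, either the blinding exponents or the commitment's opening
hide the seed. -/
theorem MPK.seed_injective_of_not_isHeader {mpk : P.MPK} (hs : mpk.Sane) {ID : ZMod P.p}
    {C : P.Ciphertext} (hC : ¬ ∃ s, mpk.IsHeader ID C s) (d' : P.Key) :
    (∀ w rB, Function.Injective fun rA => mpk.seed (mpk.unblind ID w rA rB d') C) ∨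
    (∀ rA rB R, Set.InjOn (fun w => mpk.seed (mpk.unblind ID w rA rB d') C)
      {w | commit mpk.h mpk.X w = R}) := by
  obtain ⟨g, X, h, YA, YB, Z, H⟩ := mpk
  obtain ⟨⟨a1, a2, a3⟩, ⟨b1, b2, b3⟩⟩ := d'
  obtain ⟨C1, C2, C3, C4⟩ := C
  obtain ⟨hg, hX⟩ := hs
  simp only [MPK.IsHeader, MPK.F, MPK.seed, MPK.unblind, commit, Function.Injective, Set.InjOn,
    Set.mem_ofPred_eq] at *
  generalize (H C1 C2 C3 : ZMod P.p) = κ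
  have hE := P.pairing.nondegenerate g g hg hg
  obtain ⟨x, rfl⟩ := exists_pow_val_eq P.card_G hg X
  obtain ⟨η, rfl⟩ := exists_pow_val_eq P.card_G hg h
  obtain ⟨z, rfl⟩ := exists_pow_val_eq P.card_G hg Z
  obtain ⟨a1, rfl⟩ := exists_pow_val_eq P.card_G hg a1
  obtain ⟨a2, rfl⟩ := exists_pow_val_eq P.card_G hg a2
  obtain ⟨b1, rfl⟩ := exists_pow_val_eq P.card_G hg b1
  obtain ⟨b2, rfl⟩ := exists_pow_val_eq P.card_G hg b2
  obtain ⟨c1, rfl⟩ := exists_pow_val_eq P.card_G hg C1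
  obtain ⟨c2, rfl⟩ := exists_pow_val_eq P.card_G hg C2
  obtain ⟨c3, rfl⟩ := exists_pow_val_eq P.card_GT hE C3
  have hx : x ≠ 0 := by rintro rfl; simp at hX
  simp only [pow_val_add P.card_G, pow_val_mul P.card_G, pow_val_div P.card_G,
    P.pairing.e_pow_val P.card_GT, P.pairing.e_pow_val_right, pow_val_add P.card_GT,
    pow_val_mul P.card_GT, pow_val_div P.card_GT, pow_val_inj P.card_GT hE,
    pow_val_inj P.card_G hg] at hC ⊢
  by_cases h2 : c1 * (ID + z) = c2 * x
  · right
    -- The first component forces `s = c1 / x`, and by `h2` the second agrees with it, so the third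
    -- must be the ill-formed one.
    have h3 : c1 * η ≠ c3 * x := fun h3 => hC ⟨c1 / x, by field_simp, by
      field_simp; linear_combination -h2, by field_simp; linear_combination -h3⟩
    rintro rA rB R ⟨t, θ⟩ hw ⟨t', θ'⟩ hw' h
    have hR : η * t + x * θ = η * t' + x * θ' :=
      (pow_val_inj P.card_G hg).1 (hw.trans hw'.symm)
    have ht : (t : ZMod P.p) = t' := by
      refine mul_left_cancel₀ (sub_ne_zero.2 h3) ?_
      -- The opening enters the exponent of the seed through `-(c1 * θ + c3 * t)`. Eliminating `θ`
      -- by the fibre relation leaves, up to the factor `x`, the coefficient `c1 * η - c3 * x` of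
      -- `t`.
      linear_combination x * h + c1 * hR
    have hθ : (θ : ZMod P.p) = θ' := by
      refine mul_left_cancel₀ hx ?_
      linear_combination hR - η * ht
    rw [Units.ext ht, Units.ext hθ]
  · left
    intro w rB r r' h
    refine Units.ext (mul_left_cancel₀ (sub_ne_zero.2 h2) ?_)
    -- The coefficient of `rA` in the exponent of the seed is `c1 * (ID + z) - c2 * x`.
    linear_combination h

/-- Each unit `t` extends uniquely to an opening, by `θ = (r - η * t) / x`, unless this value is
zero. At most one of the `p - 1` units is lost in this way. -/
theorem MPK.card_le_card_fiber {mpk : P.MPK} (hs : mpk.Sane)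
    (w₀ : (ZMod P.p)ˣ × (ZMod P.p)ˣ) :
    P.p - 2 ≤ (Finset.univ.filter fun w : (ZMod P.p)ˣ × (ZMod P.p)ˣ => commit mpk.h mpk.X w =
      commit mpk.h mpk.X w₀).card := by
  obtain ⟨x, η, hx, h⟩ := MPK.commit_eq_iff hs
  set r := η * w₀.1 + x * w₀.2 with hr
  have hT : P.p - 2 ≤ (Finset.univ.filter fun t : (ZMod P.p)ˣ => r - η * t ≠ 0).card := by
    have h1 : (Finset.univ.filter fun t : (ZMod P.p)ˣ => r - η * t = 0).card ≤ 1 := by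
      rw [Finset.card_le_one]
      simp only [Finset.mem_filter, Finset.mem_univ, true_and]
      intro t ht t' ht'
      by_cases hη : η = 0
      -- For `η = 0` no unit is lost, because `r = x * θ₀` is nonzero.
      · simp [hr, hη, hx] at ht
      · exact Units.ext (mul_left_cancel₀ hη (by linear_combination ht' - ht))
    have h2 := Finset.card_filter_add_card_filter_not
      (s := Finset.univ) (fun t : (ZMod P.p)ˣ => r - η * t = 0)
    rw [Finset.card_univ, ZMod.card_units] at h2
    simp only [ne_eq]
    omega
  refine hT.trans (Finset.card_le_card_of_injOn
    -- The default value `1` is never taken on the filtered set.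
    (fun t => (t, if ht : r - η * (t : ZMod P.p) ≠ 0 then Units.mk0 ((r - η * t) / x)
      (div_ne_zero ht hx) else 1)) ?_ ?_)
  · intro t ht
    have ht : r - η * (t : ZMod P.p) ≠ 0 := by simpa using ht
    simp only [Finset.coe_filter, Finset.mem_univ, true_and, Set.mem_ofPred_eq, h, dif_pos ht,
      Units.val_mk0]
    field_simp
    ring
  · intro t _ t' _ htt
    exact (Prod.ext_iff.1 htt).1

end System

/-! ### Averages over the fibres of a commitment -/

/-- On a fibre of `c` the weight `T w τ` is constant, so it factors out: given `τ` and `c w`, the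
witness is still uniform on its fibre. A bound on each fibre average therefore bounds the whole
probability. -/
theorem bind_uniform_bind_apply_le {W V C : Type} [Fintype W] [Nonempty W] (c : W → C)
    (T : W → PMF V) (hT : ∀ w w', c w = c w' → T w = T w') (k : W → V → PMF Bool) (ε : ENNReal)
    (hk : ∀ w₀ τ, ∑ w with c w = c w₀, k w τ true ≤
      (Finset.univ.filter fun w => c w = c w₀).card * ε) :
    ((PMF.uniformOfFintype W).bind fun w => (T w).bind (k w)) true ≤ ε := by
  have key : ∀ τ, ∑ w, T w τ * k w τ true ≤ ∑ w, T w τ * ε := by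
    intro τ
    have hm : ∀ w ∈ (Finset.univ : Finset W), c w ∈ Finset.univ.image c := fun w hw =>
      Finset.mem_image_of_mem c hw
    rw [← Finset.sum_fiberwise_of_maps_to hm, ← Finset.sum_fiberwise_of_maps_to hm]
    refine Finset.sum_le_sum fun R hR => ?_
    obtain ⟨w₀, -, rfl⟩ := Finset.mem_image.1 hR
    have h1 : ∀ f : W → ENNReal, ∑ w with c w = c w₀, T w τ * f w =
        T w₀ τ * ∑ w with c w = c w₀, f w := fun f => by
      rw [Finset.mul_sum]
      refine Finset.sum_congr rfl fun w hw => ?_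
      rw [hT w w₀ (Finset.mem_filter.1 hw).2]
    rw [h1 fun w => k w τ true, h1 fun _ => ε, Finset.sum_const, nsmul_eq_mul]
    gcongr
    exact hk w₀ τ
  calc ((PMF.uniformOfFintype W).bind fun w => (T w).bind (k w)) true
      = ∑ w, (Fintype.card W : ENNReal)⁻¹ * ∑' τ, T w τ * k w τ true := by
        simp only [PMF.bind_apply, tsum_fintype, PMF.uniformOfFintype_apply]
    _ = (Fintype.card W : ENNReal)⁻¹ * ∑' τ, ∑ w, T w τ * k w τ true := by
        rw [← Finset.mul_sum, Summable.tsum_finsetSum fun _ _ => ENNReal.summable]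
    _ ≤ (Fintype.card W : ENNReal)⁻¹ * ∑' τ, ∑ w, T w τ * ε := by
        exact mul_le_mul_right (ENNReal.tsum_le_tsum key) _
    _ = ε := by
        rw [Summable.tsum_finsetSum fun _ _ => ENNReal.summable]
        simp only [ENNReal.tsum_mul_right, PMF.tsum_coe, one_mul, Finset.sum_const,
          Finset.card_univ, nsmul_eq_mul]
        rw [← mul_assoc, ENNReal.inv_mul_cancel (by simp) (by simp), one_mul]

theorem bind_apply_le {α : Type} (μ : PMF α) (f : α → PMF Bool) (ε : ENNReal)
    (h : ∀ a, f a true ≤ ε) : (μ.bind f) true ≤ ε := by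
  rw [PMF.bind_apply]
  calc ∑' a, μ a * f a true ≤ ∑' a, μ a * ε := by gcongr with a; exact h a
    _ = ε := by rw [ENNReal.tsum_mul_right, PMF.tsum_coe, one_mul]

theorem sum_sum_sum_le {α β γ : Type} (s : Finset α) (t : Finset β) (u : Finset γ)
    (f : α → β → γ → ℕ) (M : ℕ) (h : ∀ b ∈ t, ∀ c ∈ u, ∑ a ∈ s, f a b c ≤ M) :
    ∑ a ∈ s, ∑ b ∈ t, ∑ c ∈ u, f a b c ≤ t.card * u.card * M := by
  have : ∑ a ∈ s, ∑ b ∈ t, ∑ c ∈ u, f a b c = ∑ b ∈ t, ∑ c ∈ u, ∑ a ∈ s, f a b c := by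
    rw [Finset.sum_comm]
    exact Finset.sum_congr rfl fun b _ => Finset.sum_comm
  rw [this, mul_assoc]
  refine (Finset.sum_le_card_nsmul t _ (u.card * M) fun b hb => ?_).trans_eq (smul_eq_mul ..)
  exact (Finset.sum_le_card_nsmul u _ M fun c hc => h b hb c hc).trans_eq (smul_eq_mul ..)

/-! ### Simulating the decryption oracle, and counting bad events -/

namespace System

variable {P : System}

/-- Two runs coincide until an answer differs, so the oracles need only agree on the queries of the
`O'` run. -/
theorem answers_congr {O O' : P.Ciphertext → Option P.M}
    {query : List (Option P.M) → Option P.Ciphertext} {q : ℕ}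
    (h : ∀ i < q, ∀ C, query (answers O' query i) = some C → O C = O' C) :
    answers O query q = answers O' query q := by
  induction q with
  | zero => rfl
  | succ q ih =>
    have hq := h q q.lt_succ_self
    simp only [answers, ih fun i hi => h i (hi.trans q.lt_succ_self)]
    cases hc : query (answers O' query q) with
    | none => rfl
    | some C => simp only [hq C hc]

variable (P) in
/-- The number of seeds under which a ciphertext is not rejected. -/
def acceptCount (c : List Bool) : ℕ :=
  (Finset.univ.filter fun γ : P.GT => (P.sym.dec (P.kdf γ) c).isSome).card

theorem sum_ite_isSome_le {α : Type} (s : Finset α) (f : α → P.GT) (hf : Set.InjOn f s)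
    (c : List Bool) :
    ∑ a ∈ s, (if (P.sym.dec (P.kdf (f a)) c).isSome then 1 else 0) ≤ P.acceptCount c := by
  rw [← Finset.card_filter]
  refine Finset.card_le_card_of_injOn f (fun a ha => ?_) (hf.mono ?_)
  · simpa using (Finset.mem_filter.1 ha).2
  · exact Finset.coe_subset.2 (Finset.filter_subset _ _)

section Counting

variable {mpk : P.MPK} {ID : ZMod P.p} {d' : P.Key}

theorem card_units_system : (Finset.univ : Finset (ZMod P.p)ˣ).card = P.p - 1 := by
  rw [Finset.card_univ, ZMod.card_units]

/-- How often, over the openings of a commitment and the blinding exponents, an ill-formed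
ciphertext is accepted. -/
theorem sum_accepted_le (hs : mpk.Sane) (w₀ : (ZMod P.p)ˣ × (ZMod P.p)ˣ) {C : P.Ciphertext}
    (hC : ¬ ∃ s, mpk.IsHeader ID C s) :
    (∑ w with commit mpk.h mpk.X w = commit mpk.h mpk.X w₀, ∑ rA, ∑ rB,
      if (mpk.decrypt (mpk.unblind ID w rA rB d') C).isSome then 1 else 0) * (P.p - 2) ≤
    P.acceptCount C.C4 * ((Finset.univ.filter fun w : (ZMod P.p)ˣ × (ZMod P.p)ˣ =>
      commit mpk.h mpk.X w = commit mpk.h mpk.X w₀).card * (P.p - 1) ^ 2) := by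
  have hN := MPK.card_le_card_fiber hs w₀
  set F := Finset.univ.filter fun w : (ZMod P.p)ˣ × (ZMod P.p)ˣ =>
    commit mpk.h mpk.X w = commit mpk.h mpk.X w₀ with hF
  simp only [MPK.decrypt_eq]
  rcases MPK.seed_injective_of_not_isHeader hs hC d' with h | h
  · have h1 := sum_sum_sum_le (Finset.univ : Finset (ZMod P.p)ˣ) F Finset.univ
      (fun rA w rB => if (P.sym.dec (P.kdf (mpk.seed (mpk.unblind ID w rA rB d') C))
        C.C4).isSome then 1 else 0) (P.acceptCount C.C4)
      fun w _ rB _ => sum_ite_isSome_le _ _ ((h w rB).injOn) _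
    rw [Finset.sum_comm, card_units_system] at h1
    -- Here the injection covers all `p - 1` values of `rA`; weakening to `p - 2` matches the other
    -- case.
    refine (Nat.mul_le_mul h1 (Nat.sub_le_sub_left one_le_two _)).trans_eq ?_
    ring
  · have h1 := sum_sum_sum_le F (Finset.univ : Finset (ZMod P.p)ˣ)
      (Finset.univ : Finset (ZMod P.p)ˣ)
      (fun w rA rB => if (P.sym.dec (P.kdf (mpk.seed (mpk.unblind ID w rA rB d') C))
        C.C4).isSome then 1 else 0) (P.acceptCount C.C4)
      fun rA _ rB _ => sum_ite_isSome_le _ _ 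
        ((h rA rB (commit mpk.h mpk.X w₀)).mono (by simp [hF])) _
    rw [card_units_system] at h1
    refine (Nat.mul_le_mul h1 hN).trans_eq ?_
    ring

/-- How often a guess of the family number is correct. -/
theorem sum_guessed_le (hs : mpk.Sane) (w₀ : (ZMod P.p)ˣ × (ZMod P.p)ˣ) (v : ZMod P.p) :
    (∑ w with commit mpk.h mpk.X w = commit mpk.h mpk.X w₀,
      ∑ rA : (ZMod P.p)ˣ, ∑ rB : (ZMod P.p)ˣ,
      if (mpk.unblind ID w rA rB d').A.d3 = v then 1 else 0) * (P.p - 2) ≤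
    (Finset.univ.filter fun w : (ZMod P.p)ˣ × (ZMod P.p)ˣ =>
      commit mpk.h mpk.X w = commit mpk.h mpk.X w₀).card * (P.p - 1) ^ 2 := by
  have hN := MPK.card_le_card_fiber hs w₀
  set F := Finset.univ.filter fun w : (ZMod P.p)ˣ × (ZMod P.p)ˣ =>
    commit mpk.h mpk.X w = commit mpk.h mpk.X w₀ with hF
  have h1 := sum_sum_sum_le F (Finset.univ : Finset (ZMod P.p)ˣ)
      (Finset.univ : Finset (ZMod P.p)ˣ)
      (fun w rA rB => if (mpk.unblind ID w rA rB d').A.d3 = v then 1 else 0) 1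
      fun rA _ rB _ => by
        rw [← Finset.card_filter, Finset.card_le_one]
        intro w hw w' hw'
        simp only [Finset.mem_filter, hF, Finset.mem_univ, true_and] at hw hw'
        refine MPK.fst_injOn_commit hs _ hw.1 hw'.1 (Units.ext ?_)
        exact add_left_cancel (hw.2.trans hw'.2.symm)
  rw [card_units_system] at h1
  refine (Nat.mul_le_mul h1 hN).trans_eq ?_
  ring

/-- How often the adversary wins, given its view of the key generation protocol. -/
theorem sum_win_le (hs : mpk.Sane) (w₀ : (ZMod P.p)ˣ × (ZMod P.p)ˣ) (q L M : ℕ)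
    (query : List (Option P.M) → Option P.Ciphertext) (find : List (Option P.M) → P.Key)
    (hL : ∀ as C, query as = some C → C.C4.length ≤ L)
    (hM : ∀ c : List Bool, c.length ≤ L → P.acceptCount c ≤ M) :
    (∑ w with commit mpk.h mpk.X w = commit mpk.h mpk.X w₀, ∑ rA, ∑ rB,
      if mpk.KeyValid ID (mpk.unblind ID w rA rB d') ∧
        mpk.trace ID (mpk.unblind ID w rA rB d') = mpk.trace ID
          (find (answers (mpk.decrypt (mpk.unblind ID w rA rB d')) query q))
      then 1 else 0) * (P.p - 2) ≤
    (1 + q * M) * ((Finset.univ.filter fun w : (ZMod P.p)ˣ × (ZMod P.p)ˣ =>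
      commit mpk.h mpk.X w = commit mpk.h mpk.X w₀).card * (P.p - 1) ^ 2) := by
  set as := answers (mpk.publicDecrypt ID) query with has
  set N := (Finset.univ.filter fun w : (ZMod P.p)ˣ × (ZMod P.p)ˣ =>
      commit mpk.h mpk.X w = commit mpk.h mpk.X w₀).card
  -- Badness is defined along the simulated run `as`, whose queries do not depend on `d`. This makes
  -- adaptive queries amenable to a union bound.
  let bad (i : ℕ) (d : P.Key) : Prop := ∃ C, query (as i) = some C ∧
    (¬ ∃ s, mpk.IsHeader ID C s) ∧ (mpk.decrypt d C).isSome
  have hwin : ∀ d : P.Key, (if mpk.KeyValid ID d ∧ mpk.trace ID d = mpk.trace ID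
      (find (answers (mpk.decrypt d) query q)) then 1 else 0) ≤
      (if d.A.d3 = (find (as q)).A.d3 then 1 else 0) +
        ∑ i ∈ Finset.range q, if bad i d then 1 else 0 := by
    intro d
    split_ifs with h1 h2
    · exact Nat.le_add_right _ _
    · rw [zero_add, Nat.one_le_iff_ne_zero, Ne, Finset.sum_eq_zero_iff]
      intro h3
      have h4 : answers (mpk.decrypt d) query q = as q := by
        refine answers_congr fun i hi C hC => ?_
        have h5 : ¬ bad i d := by simpa using h3 i (Finset.mem_range.2 hi)
        by_cases h6 : ∃ s, mpk.IsHeader ID C s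
        · exact MPK.decrypt_eq_publicDecrypt hs h1.1 h6
        · rw [MPK.publicDecrypt, dif_neg h6]
          by_contra h7
          exact h5 ⟨C, hC, h6, Option.isSome_iff_ne_none.2 h7⟩
      obtain ⟨h5, h6⟩ := h1
      rw [h4, MPK.trace, if_pos h5, MPK.trace] at h6
      split_ifs at h6
      exact h2 (Option.some_injective _ h6)
    · exact Nat.zero_le _
    · exact Nat.zero_le _
  have hbad : ∀ i, (∑ w with commit mpk.h mpk.X w = commit mpk.h mpk.X w₀, ∑ rA, ∑ rB,
      if bad i (mpk.unblind ID w rA rB d') then 1 else 0) * (P.p - 2) ≤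
      M * (N * (P.p - 1) ^ 2) := by
    intro i
    by_cases h : ∃ C, query (as i) = some C ∧ ¬ ∃ s, mpk.IsHeader ID C s
    · obtain ⟨C, hC, hH⟩ := h
      have h1 : ∀ d, bad i d ↔ (mpk.decrypt d C).isSome := fun d =>
        ⟨fun ⟨C', hC', _, h2⟩ => by rwa [Option.some_injective _ (hC.symm.trans hC')],
          fun h2 => ⟨C, hC, hH, h2⟩⟩
      simp only [h1]
      exact (sum_accepted_le hs w₀ hH).trans (Nat.mul_le_mul_right _ (hM _ (hL _ _ hC)))
    · have h1 : ∀ d, ¬ bad i d := fun d ⟨C, hC, hH, _⟩ => h ⟨C, hC, hH⟩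
      simp [h1]
  calc _ ≤ (∑ w with commit mpk.h mpk.X w = commit mpk.h mpk.X w₀, ∑ rA, ∑ rB,
        ((if (mpk.unblind ID w rA rB d').A.d3 = (find (as q)).A.d3 then 1 else 0) +
        ∑ i ∈ Finset.range q, if bad i (mpk.unblind ID w rA rB d') then 1 else 0)) *
          (P.p - 2) := by
        gcongr with w _ rA _ rB _
        exact hwin _
    _ = (∑ w with commit mpk.h mpk.X w = commit mpk.h mpk.X w₀,
        ∑ rA : (ZMod P.p)ˣ, ∑ rB : (ZMod P.p)ˣ,
        if (mpk.unblind ID w rA rB d').A.d3 = (find (as q)).A.d3 then 1 else 0) * (P.p - 2) +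
        ∑ i ∈ Finset.range q, (∑ w with commit mpk.h mpk.X w = commit mpk.h mpk.X w₀,
          ∑ rA, ∑ rB, if bad i (mpk.unblind ID w rA rB d') then 1 else 0) * (P.p - 2) := by
        simp only [Finset.sum_add_distrib, add_mul, ← Finset.sum_mul]
        congr 2
        rw [Finset.sum_comm (s := Finset.range q)]
        refine Finset.sum_congr rfl fun w _ => ?_
        rw [Finset.sum_comm (s := Finset.range q)]
        refine Finset.sum_congr rfl fun rA _ => ?_
        rw [Finset.sum_comm (s := Finset.range q)]
    _ ≤ N * (P.p - 1) ^ 2 + ∑ i ∈ Finset.range q, M * (N * (P.p - 1) ^ 2) :=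
        add_le_add (sum_guessed_le hs w₀ _) (Finset.sum_le_sum fun i _ => hbad i)
    _ = _ := by rw [Finset.sum_const, Finset.card_range, smul_eq_mul]; ring

end Counting

/-! ### The game -/

/-- Once the adversary's coins are fixed, witness indistinguishability makes the transcript's law a
function of the commitment. The win probability is then averaged over fibres, where `sum_win_le`
counts. -/
theorem findKeyGame_apply_le (hWI : P.prover.PerfectlyWI) (hp : 2 < P.p) (A : P.Adversary)
    (q L M : ℕ) (hL : A.QueryLength L)
    (hM : ∀ c : List Bool, c.length ≤ L → P.acceptCount c ≤ M) :
    findKeyGame A q true ≤ ((1 + q * M : ℕ) : ENNReal) / ((P.p - 2 : ℕ) : ENNReal) := by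
  refine bind_apply_le _ _ _ fun ω => ?_
  dsimp only
  split_ifs with hs
  swap
  · simp
  set mpk := (A.setup ω).1
  set ID := (A.setup ω).2
  let T (w : (ZMod P.p)ˣ × (ZMod P.p)ˣ) : PMF (List P.prover.PMsg) :=
    P.prover.coin.map (P.prover.run mpk.h mpk.X w (A.verifier ω (commit mpk.h mpk.X w)))
  let k (w : (ZMod P.p)ˣ × (ZMod P.p)ˣ) (τ : List P.prover.PMsg) : PMF Bool :=
    (PMF.uniformOfFintype (ZMod P.p)ˣ).bind fun rA =>
      (PMF.uniformOfFintype (ZMod P.p)ˣ).bind fun rB =>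
        let R := commit mpk.h mpk.X w
        let d := mpk.unblind ID w rA rB (A.issue ω R τ)
        if mpk.KeyValid ID d then
          let as := answers (mpk.decrypt d) (A.query ω R τ) q
          let d₂ := A.findkey ω R τ as
          PMF.pure (decide (mpk.trace ID d = mpk.trace ID d₂))
        else PMF.pure false
  have main := bind_uniform_bind_apply_le (commit mpk.h mpk.X) T
    (fun w w' h => by simp only [T, h, hWI _ _ w w' h]) k
    (((1 + q * M : ℕ) : ENNReal) / ((P.p - 2 : ℕ) : ENNReal)) ?_
  · simp only [T, PMF.bind_map] at main
    exact main
  intro w₀ τ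
  have hp1 : ((P.p - 1 : ℕ) : ENNReal) ≠ 0 := Nat.cast_ne_zero.2 (by omega)
  have hp2 : ((P.p - 2 : ℕ) : ENNReal) ≠ 0 := Nat.cast_ne_zero.2 (by omega)
  set R := commit mpk.h mpk.X w₀ with hR
  let win (w : (ZMod P.p)ˣ × (ZMod P.p)ˣ) (rA rB : (ZMod P.p)ˣ) : ℕ :=
    if mpk.KeyValid ID (mpk.unblind ID w rA rB (A.issue ω R τ)) ∧
      mpk.trace ID (mpk.unblind ID w rA rB (A.issue ω R τ)) = mpk.trace ID
        (A.findkey ω R τ (answers (mpk.decrypt (mpk.unblind ID w rA rB (A.issue ω R τ)))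
          (A.query ω R τ) q)) then 1 else 0
  -- For a fixed opening and transcript only the two uniform blinding exponents are random, so the
  -- probability is a count over `(p - 1) ^ 2`.
  have hk : ∀ w, commit mpk.h mpk.X w = R →
      k w τ true = (((P.p - 1 : ℕ) : ENNReal) ^ 2)⁻¹ * (∑ rA, ∑ rB, win w rA rB : ℕ) := by
    intro w hw
    simp only [k, hw, PMF.bind_apply, tsum_fintype, PMF.uniformOfFintype_apply, ZMod.card_units,
      Nat.cast_sum]
    simp only [← Finset.mul_sum]
    rw [← mul_assoc, ← sq, ENNReal.inv_pow]
    congr 1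
    refine Finset.sum_congr rfl fun rA _ => Finset.sum_congr rfl fun rB _ => ?_
    simp only [win]
    split_ifs with h1 h2 h2
    · simp [h2.2]
    · simpa using fun h3 => h2 ⟨h1, h3⟩
    · exact absurd h2.1 h1
    · simp
  have hsum : ∑ w with commit mpk.h mpk.X w = R, k w τ true = (((P.p - 1 : ℕ) : ENNReal) ^ 2)⁻¹ *
      (∑ w with commit mpk.h mpk.X w = R, ∑ rA, ∑ rB, win w rA rB : ℕ) := by
    rw [Nat.cast_sum, Finset.mul_sum]
    exact Finset.sum_congr rfl fun w hw => hk w (Finset.mem_filter.1 hw).2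
  have hcount := sum_win_le (d' := A.issue ω R τ) (ID := ID) hs w₀ q L M (A.query ω R τ)
    (A.findkey ω R τ) (hL ω R τ) hM
  rw [hsum, mul_comm, ← div_eq_mul_inv, ← mul_div_assoc,
    ENNReal.div_le_iff (pow_ne_zero 2 hp1) (by simp), ← ENNReal.mul_div_right_comm,
    ENNReal.le_div_iff_mul_le (Or.inl hp2) (Or.inl (by simp))]
  exact_mod_cast hcount.trans_eq (by ring)

end System

/-! ### Circuits with hardwired inputs -/

/-- A fixed input becomes a constant wire, so hardwiring costs no gates. -/
def Wire.hardwire {n m k : ℕ} (c : Fin m → Bool) : Wire (n + m) k → Wire n k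
  | .const b => .const b
  | .input i => Fin.addCases .input (fun j => .const (c j)) i
  | .gate j => .gate j

theorem Wire.eval_hardwire {n m k : ℕ} (c : Fin m → Bool) (x : Fin n → Bool) (v : Fin k → Bool)
    (a : Wire (n + m) k) : (a.hardwire c).eval x v = a.eval (Fin.append x c) v := by
  cases a with
  | const b => rfl
  | gate j => rfl
  | input i => refine Fin.addCases (fun i => ?_) (fun j => ?_) i <;> simp [hardwire, eval]

def Gates.hardwire {n m : ℕ} (c : Fin m → Bool) : {k : ℕ} → Gates (n + m) k → Gates n k
  | _, .nil => .nil
  | _, .nand gs a b => .nand (gs.hardwire c) (a.hardwire c) (b.hardwire c)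

theorem Gates.eval_hardwire {n m k : ℕ} (c : Fin m → Bool) (x : Fin n → Bool)
    (gs : Gates (n + m) k) : (gs.hardwire c).eval x = gs.eval (Fin.append x c) := by
  induction gs with
  | nil => rfl
  | nand gs a b ih => simp only [hardwire, eval, ih, Wire.eval_hardwire]

/-- The circuit in which the last `m` inputs are fixed to `c`. -/
def Circuit.hardwire {n m : ℕ} (C : Circuit (n + m)) (c : Fin m → Bool) : Circuit n :=
  ⟨C.size, C.gates.hardwire c, C.out.hardwire c⟩

theorem Circuit.eval_hardwire {n m : ℕ} (C : Circuit (n + m)) (c : Fin m → Bool)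
    (x : Fin n → Bool) : (C.hardwire c).eval x = C.eval (Fin.append x c) := by
  simp only [eval, hardwire, Gates.eval_hardwire, Wire.eval_hardwire]

namespace System

variable (P : System)

/-! ### The assumptions -/

theorem _root_.PMF.toReal_apply_le_one {α : Type} (μ : PMF α) (a : α) : (μ a).toReal ≤ 1 :=
  ENNReal.toReal_le_of_le_ofReal zero_le_one (by simpa using μ.coe_le_one a)

theorem kdfAdvantage_nonneg (B : Circuit P.ℓ) : 0 ≤ P.kdfAdvantage B := abs_nonneg _

theorem kdfAdvantage_le_one (B : Circuit P.ℓ) : P.kdfAdvantage B ≤ 1 :=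
  abs_sub_le_of_nonneg_of_le ENNReal.toReal_nonneg (PMF.toReal_apply_le_one _ _)
    ENNReal.toReal_nonneg (PMF.toReal_apply_le_one _ _)

theorem ctIntAdvantage_nonneg (B : PMF (List Bool)) : 0 ≤ P.ctIntAdvantage B :=
  ENNReal.toReal_nonneg

theorem ctIntAdvantage_le_one (B : PMF (List Bool)) : P.ctIntAdvantage B ≤ 1 :=
  PMF.toReal_apply_le_one _ _

theorem bddAbove_kdfAdvantage (s : ℕ) :
    BddAbove (Set.range fun B : {B : Circuit P.ℓ // B.size ≤ s} => P.kdfAdvantage B) :=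
  ⟨1, by rintro _ ⟨B, rfl⟩; exact P.kdfAdvantage_le_one B⟩

theorem bddAbove_ctIntAdvantage (L : ℕ) : BddAbove (Set.range
    fun B : {B : PMF (List Bool) // ∀ c ∈ B.support, c.length ≤ L} => P.ctIntAdvantage B) :=
  ⟨1, by rintro _ ⟨B, rfl⟩; exact P.ctIntAdvantage_le_one B⟩

theorem advKDF_nonneg (s : ℕ) : 0 ≤ P.advKDF s :=
  Real.iSup_nonneg fun B => P.kdfAdvantage_nonneg B

theorem advCTInt_nonneg (L : ℕ) : 0 ≤ P.advCTInt L :=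
  Real.iSup_nonneg fun B => P.ctIntAdvantage_nonneg B

/-- The supremum need not be attained, but some index reaches half of it. The factor 2 is harmless
for negligibility. -/
theorem exists_le_two_mul_of_iSup {ι : Type} [Nonempty ι] (f : ι → ℝ) (h0 : ∀ i, 0 ≤ f i) :
    ∃ i, ⨆ i, f i ≤ 2 * f i := by
  rcases (Real.iSup_nonneg h0).eq_or_lt with h | h
  · exact ⟨Classical.arbitrary ι, by rw [← h]; linarith [h0 (Classical.arbitrary ι)]⟩
  · obtain ⟨i, hi⟩ := exists_lt_of_lt_ciSup (half_lt_self h)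
    exact ⟨i, by linarith⟩

theorem exists_advKDF_le (s : ℕ) :
    ∃ B : Circuit P.ℓ, B.size ≤ s ∧ P.advKDF s ≤ 2 * P.kdfAdvantage B := by
  have : Nonempty {B : Circuit P.ℓ // B.size ≤ s} := ⟨⟨0, .nil, .const true⟩, s.zero_le⟩
  obtain ⟨B, hB⟩ := exists_le_two_mul_of_iSup
    (fun B : {B : Circuit P.ℓ // B.size ≤ s} => P.kdfAdvantage B)
    fun B => P.kdfAdvantage_nonneg B
  exact ⟨B, B.2, hB⟩

theorem exists_advCTInt_le (L : ℕ) : ∃ B : PMF (List Bool),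
    (∀ c ∈ B.support, c.length ≤ L) ∧ P.advCTInt L ≤ 2 * P.ctIntAdvantage B := by
  have : Nonempty {B : PMF (List Bool) // ∀ c ∈ B.support, c.length ≤ L} :=
    ⟨PMF.pure [], by simp⟩
  obtain ⟨B, hB⟩ := exists_le_two_mul_of_iSup
    (fun B : {B : PMF (List Bool) // ∀ c ∈ B.support, c.length ≤ L} => P.ctIntAdvantage B)
    fun B => P.ctIntAdvantage_nonneg B
  exact ⟨B, B.2, hB⟩

theorem _root_.PMF.map_uniformOfFintype_apply_true {α : Type} [Fintype α] [Nonempty α]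
    (f : α → Bool) : ((PMF.uniformOfFintype α).map f true).toReal =
      (Finset.univ.filter fun a => f a).card / Fintype.card α := by
  simp only [PMF.map_apply, tsum_fintype, PMF.uniformOfFintype_apply, eq_comm (a := true)]
  rw [← Finset.sum_filter, Finset.sum_const, nsmul_eq_mul, ENNReal.toReal_mul,
    ENNReal.toReal_inv, ENNReal.toReal_natCast, ENNReal.toReal_natCast, div_eq_mul_inv]

/-- The fraction of accepting seeds is the probability that `c` is accepted under `KDF(γ)`. The
decision circuit with `c` hardwired is a KDF distinguisher, so a uniform key changes this by at most
`advKDF`. What remains is the integrity advantage of always outputting `c`. -/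
theorem acceptCount_le {L s : ℕ} (hD : P.DecSize L s) {c : List Bool} (hc : c.length ≤ L) :
    (P.acceptCount c : ℝ) ≤ P.p * (P.advCTInt L + P.advKDF s) := by
  obtain ⟨C, hCs, hC⟩ := hD c.length hc
  have hB : ∀ K, (C.hardwire c.get).eval K = (P.sym.dec K c).isSome := fun K => by
    rw [Circuit.eval_hardwire, hC, List.ofFn_get]
  have hkdf : P.kdfAdvantage (C.hardwire c.get) ≤ P.advKDF s :=
    le_ciSup (P.bddAbove_kdfAdvantage s) ⟨C.hardwire c.get, hCs⟩
  have hct : P.ctIntAdvantage (PMF.pure c) ≤ P.advCTInt L :=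
    le_ciSup (P.bddAbove_ctIntAdvantage L) ⟨PMF.pure c, by simpa using hc⟩
  have hcard : (Fintype.card P.GT : ℝ) = P.p := by
    rw [← Nat.card_eq_fintype_card, P.card_GT]
  have hp : (0 : ℝ) < P.p := Nat.cast_pos.2 P.prime.out.pos
  rw [kdfAdvantage] at hkdf
  simp only [hB] at hkdf
  rw [ctIntAdvantage] at hct
  simp only [PMF.pure_map] at hct
  have hct' : ((PMF.uniformOfFintype (Fin P.ℓ → Bool)).map
      (fun K => (P.sym.dec K c).isSome) true).toReal ≤ P.advCTInt L := hct
  have h1 := (le_abs_self _).trans hkdf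
  rw [PMF.map_uniformOfFintype_apply_true (fun γ => (P.sym.dec (P.kdf γ) c).isSome), hcard] at h1
  have h2 : (P.acceptCount c : ℝ) / P.p ≤ P.advCTInt L + P.advKDF s := by
    simp only [acceptCount]
    linarith
  rwa [div_le_iff₀' hp] at h2

/-! ### The concrete bound -/

variable {P}

theorem Adversary.advantage_nonneg (A : P.Adversary) (q : ℕ) : 0 ≤ A.advantage q :=
  ENNReal.toReal_nonneg

/-- For `p > 4` one has `p - 2 ≥ p / 2`, which yields the factor 2 and an error of `2 / p`. For `p ≤
4` the term `4 / p` already exceeds every probability. -/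
theorem Adversary.advantage_le (hWI : P.prover.PerfectlyWI) {L s : ℕ} (hD : P.DecSize L s)
    (A : P.Adversary) (hL : A.QueryLength L) (q : ℕ) :
    A.advantage q ≤ 2 * (q : ℝ) * P.advCTInt L + 2 * (q : ℝ) * P.advKDF s + 4 / (P.p : ℝ) := by
  have hct := P.advCTInt_nonneg L
  have hkdf := P.advKDF_nonneg s
  have hp0 : (0 : ℝ) < P.p := Nat.cast_pos.2 P.prime.out.pos
  rcases le_or_gt P.p 4 with hp | hp
  · have h1 : (1 : ℝ) ≤ 4 / P.p := by
      rw [le_div_iff₀ hp0]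
      exact_mod_cast (one_mul P.p).trans_le hp
    have h2 : A.advantage q ≤ 1 := PMF.toReal_apply_le_one _ _
    have h3 : 0 ≤ 2 * (q : ℝ) * P.advCTInt L := by positivity
    have h4 : 0 ≤ 2 * (q : ℝ) * P.advKDF s := by positivity
    linarith
  · set ε := P.advCTInt L + P.advKDF s with hε
    have hε0 : 0 ≤ ε := add_nonneg hct hkdf
    have hM : ∀ c : List Bool, c.length ≤ L → P.acceptCount c ≤ ⌊P.p * ε⌋₊ := fun c hc =>
      Nat.le_floor (P.acceptCount_le hD hc)
    have h1 := ENNReal.toReal_mono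
      (ENNReal.div_ne_top (ENNReal.natCast_ne_top _) (Nat.cast_ne_zero.2 (by omega)))
      (findKeyGame_apply_le hWI (by omega) A q L _ hL hM)
    rw [ENNReal.toReal_div, ENNReal.toReal_natCast, ENNReal.toReal_natCast] at h1
    refine h1.trans ?_
    have hp2 : (P.p : ℝ) / 2 ≤ ((P.p - 2 : ℕ) : ℝ) := by
      rw [Nat.cast_sub (by omega)]
      have : (4 : ℝ) < P.p := by exact_mod_cast hp
      push_cast
      linarith
    have hfl : (⌊P.p * ε⌋₊ : ℝ) ≤ P.p * ε := Nat.floor_le (by positivity)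
    calc ((1 + q * ⌊P.p * ε⌋₊ : ℕ) : ℝ) / ((P.p - 2 : ℕ) : ℝ)
        ≤ (1 + q * (P.p * ε)) / (P.p / 2) := by
          push_cast
          gcongr
      _ = 2 * q * ε + 2 / P.p := by field_simp; ring
      _ ≤ 2 * q * ε + 4 / P.p := by gcongr; norm_num
      _ = _ := by rw [hε]; ring

end System

/-! ### Asymptotic security -/

open Filter Asymptotics

theorem PolyBounded.exists_real {q : ℕ → ℕ} (hq : PolyBounded q) :
    ∃ Q : Polynomial ℝ, ∀ n : ℕ, (q n : ℝ) ≤ Q.eval (n : ℝ) := by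
  obtain ⟨Q, hQ⟩ := hq
  refine ⟨Q.map (Nat.castRingHom ℝ), fun n => ?_⟩
  rw [← eq_natCast (Nat.castRingHom ℝ) n, Polynomial.eval_map_apply, eq_natCast]
  exact_mod_cast hQ n

theorem Negligible.of_le {f g : ℕ → ℝ} (hg : Negligible g) (hf : ∀ n, 0 ≤ f n)
    (hfg : ∀ n, f n ≤ g n) : Negligible f :=
  SuperpolynomialDecay.trans_abs_le hg fun n => abs_le_abs_of_nonneg (hf n) (hfg n)

theorem Negligible.polyBounded_mul {q : ℕ → ℕ} (hq : PolyBounded q) {f : ℕ → ℝ}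
    (hf : Negligible f) (hf0 : ∀ n, 0 ≤ f n) : Negligible fun n => (q n : ℝ) * f n := by
  obtain ⟨Q, hQ⟩ := hq.exists_real
  exact Negligible.of_le (SuperpolynomialDecay.polynomial_mul hf Q)
    (fun n => mul_nonneg (Nat.cast_nonneg _) (hf0 n))
    fun n => mul_le_mul_of_nonneg_right (hQ n) (hf0 n)

theorem negligible_inv_two_pow : Negligible fun n => ((2 : ℝ) ^ n)⁻¹ := fun k => by
  simpa only [div_eq_mul_inv] using tendsto_pow_const_div_const_pow_of_one_lt k one_lt_two

/-- Because the distinguishers are non-uniform, a near-optimal circuit may be chosen separately for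
each `n`; these form one polynomial-size family. -/
theorem negligible_advKDF {P : ℕ → System} (h : SecureKDF P) {s : ℕ → ℕ} (hs : PolyBounded s) :
    Negligible fun n => (P n).advKDF (s n) := by
  choose B hBs hB using fun n => (P n).exists_advKDF_le (s n)
  obtain ⟨Q, hQ⟩ := hs
  exact Negligible.of_le ((h B ⟨Q, fun n => (hBs n).trans (hQ n)⟩).const_mul 2)
    (fun n => (P n).advKDF_nonneg _) hB

theorem negligible_advCTInt {P : ℕ → System} (h : WeakCTInt P) {L : ℕ → ℕ}
    (hL : PolyBounded L) : Negligible fun n => (P n).advCTInt (L n) := by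
  choose B hBL hB using fun n => (P n).exists_advCTInt_le (L n)
  exact Negligible.of_le ((h L hL B hBL).const_mul 2) (fun n => (P n).advCTInt_nonneg _) hB

theorem findKeyCCASecure {P : ℕ → System} (hp : ∀ n, 2 ^ n < (P n).p)
    (hWI : ∀ n, (P n).prover.PerfectlyWI) (hD : EfficientDec P) (hkdf : SecureKDF P)
    (hct : WeakCTInt P) : FindKeyCCASecure P := by
  intro A q L hq hL hA
  obtain ⟨s, hs, hDs⟩ := hD L hL
  have h1 := (((negligible_advCTInt hct hL).polyBounded_mul hq
    fun n => (P n).advCTInt_nonneg _).const_mul 2).add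
    (((negligible_advKDF hkdf hs).polyBounded_mul hq
      fun n => (P n).advKDF_nonneg _).const_mul 2) |>.add (negligible_inv_two_pow.const_mul 4)
  refine Negligible.of_le h1 (fun n => (A n).advantage_nonneg _) fun n =>
    ((A n).advantage_le (hWI n) (hDs n) (hA n) (q n)).trans ?_
  have h2 : (4 : ℝ) / (P n).p ≤ 4 * ((2 : ℝ) ^ n)⁻¹ := by
    rw [div_eq_mul_inv]
    gcongr
    exact_mod_cast (hp n).le
  simp only [Pi.add_apply]
  linarith

end AIBE

end

theorem mainTheorem12 :
    (∀ P : AIBE.System, P.prover.PerfectlyWI →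
      ∀ q L s : ℕ, 1 ≤ q → P.DecSize L s →
        ∀ A : P.Adversary, A.QueryLength L →
          A.advantage q ≤ 2 * (q : ℝ) * P.advCTInt L + 2 * (q : ℝ) * P.advKDF s +
            (2 * (q : ℝ) ^ 2 + (q : ℝ) + 1) / (P.p : ℝ)) ∧
    (∀ P : ℕ → AIBE.System, (∀ n, 2 ^ n < (P n).p) → (∀ n, (P n).prover.PerfectlyWI) →
      AIBE.EfficientDec P → AIBE.SecureKDF P → AIBE.WeakCTInt P →
        AIBE.FindKeyCCASecure P) := by
  refine ⟨fun P hWI q L s hq hD A hL => (A.advantage_le hWI hD hL q).trans ?_,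
    fun P hp hWI hD hkdf hct => AIBE.findKeyCCASecure hp hWI hD hkdf hct⟩
  have hq' : (1 : ℝ) ≤ q := by exact_mod_cast hq
  gcongr
  -- The remaining claim is `4 ≤ 2 * q ^ 2 + q + 1`, an equality at `q = 1`.
  nlinarith
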